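/- Let $\widehat{\mathbb R}=\mathbb R\cup\{\infty\}$ be the one-point compactification of $\mathbb R$ (a topological circle), with its unique compatible uniform structure, and let $\text{Möb}^+(\widehat{\mathbb R})$ be the group of homeomorphisms of $\widehat{\mathbb R}$ of the form $x\mapsto \frac{ax+b}{cx+d}$ with $a,b,c,d\in\mathbb R$, $ad-bc=1$. For $k>0$, an orientation preserving homeomorphism $f$ of $\widehat{\mathbb R}$ is called $k$-quasisymmetric if there is $m\in\text{Möb}^+(\widehat{\mathbb R})$ such that $h=m\circ f$ fixes $\infty$ and $$\frac1k\le\frac{h(x+t)-h(x)}{h(x)-h(x-t)}\le k\qquad\text{for all }x\in\mathbb R,\ t>0.$$ A family $\mathcal F$ of orientation preserving homeomorphisms of $\widehat{\mathbb R}$ is uniformly quasisymmetric if there is a $k>0$ such that every $f\in\mathcal F$ is $k$-quasisymmetric. A family $\mathcal F$ of orientation preserving homeomorphisms of $\widehat{\mathbb R}$ is called a convergence family if every sequence in $\mathcal F$ has a subsequence $(f_n)$ such that either - $(f_n)$ converges uniformly to an orientation preserving homeomorphism of $\widehat{\mathbb R}$, or - there are points $a,r\in\widehat{\mathbb R}$,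 possibly equal, such that for every open neighbourhood $U$ of $r$ the maps $f_n$ converge to the constant map $a$ uniformly on $\widehat{\mathbb R}\setminus U$. A group of homeomorphisms of $\widehat{\mathbb R}$ that is a convergence family is called a convergence group. **Proposition.** Every uniformly quasisymmetric family of homeomorphisms of $\widehat{\mathbb R}$ is a convergence family. In particular, $\text{Möb}^+(\widehat{\mathbb R})$ is a convergence group. -/

import Mathlib

/-- The extended real line `ℝ̂ = ℝ ∪ {∞}`, with the topology of the one-point compactification
(a topological circle). -/
abbrev RHat : Type := OnePoint ℝ

namespace RHat

open OnePoint Filter Topology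

/-- `Cyc a b c`: the points `a, b, c` of `ℝ̂` are pairwise distinct and occur in this order when the
circle `ℝ̂` is traversed in the positive direction (increasing along `ℝ`, then through `∞`). -/
def Cyc : RHat → RHat → RHat → Prop
  | .some x, .some y, .some z => (x < y ∧ y < z) ∨ (y < z ∧ z < x) ∨ (z < x ∧ x < y)
  | .some x, .some y, .infty => x < y
  | .some x, .infty, .some z => z < x
  | .infty, .some y, .some z => y < z
  | _, _, _ => False

/-- A homeomorphism of `ℝ̂` preserves orientation if it preserves the cyclic order. -/
def OrientationPreserving (f : RHat ≃ₜ RHat) : Prop :=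
  ∀ a b c : RHat, Cyc a b c → Cyc (f a) (f b) (f c)

/-- Auxiliary: the quotient `(u, v) ↦ u / v ∈ ℝ̂` is continuous away from `(0, 0)`. -/
theorem tendsto_quot {ι : Type*} {l : Filter ι} {u v : ι → ℝ} {p q : ℝ} (hpq : q = 0 → p ≠ 0)
    (hu : Tendsto u l (𝓝 p)) (hv : Tendsto v l (𝓝 q)) :
    Tendsto (fun x => if v x = 0 then (∞ : RHat) else ((u x / v x : ℝ) : RHat)) l
      (𝓝 (if q = 0 then (∞ : RHat) else ((p / q : ℝ) : RHat))) := by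
  by_cases hq : q = 0
  · have hp := hpq hq
    subst hq
    rw [if_pos rfl]
    refine Tendsto.if tendsto_const_nhds ?_
    have h1 : Tendsto (fun x => v x) (l ⊓ 𝓟 {x | ¬ v x = 0}) (𝓝[≠] 0) := by
      refine tendsto_nhdsWithin_iff.2 ⟨hv.mono_left inf_le_left, ?_⟩
      exact mem_inf_of_right (mem_principal.2 fun x hx => hx)
    have h2 : Tendsto (fun x => u x / v x) (l ⊓ 𝓟 {x | ¬ v x = 0}) (Bornology.cobounded ℝ) := by
      have h3 := tendsto_norm_atTop_iff_cobounded.2 (tendsto_inv₀_nhdsNE_zero.comp h1)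
      have h4 : Tendsto (fun x => ‖u x‖) (l ⊓ 𝓟 {x | ¬ v x = 0}) (𝓝 ‖p‖) :=
        (hu.mono_left inf_le_left).norm
      rw [← tendsto_norm_atTop_iff_cobounded]
      refine (h4.pos_mul_atTop (norm_pos_iff.2 hp) h3).congr fun x => ?_
      simp [div_eq_mul_inv]
    rw [Metric.cobounded_eq_cocompact, ← coclosedCompact_eq_cocompact] at h2
    exact OnePoint.tendsto_coe_infty.comp h2
  · rw [if_neg hq]
    have h1 : Tendsto (fun x => ((u x / v x : ℝ) : RHat)) l (𝓝 ((p / q : ℝ) : RHat)) :=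
      (OnePoint.continuous_coe.tendsto _).comp (hu.div hv hq)
    refine h1.congr' ?_
    filter_upwards [hv.eventually_ne hq] with x hx
    rw [if_neg hx]

/-- The fractional linear action of `GL(2, ℝ)` on `ℝ̂` is by continuous maps. -/
theorem continuous_smul (g : GL (Fin 2) ℝ) : Continuous fun x : RHat => g • x := by
  have hdet : g 0 0 * g 1 1 - g 0 1 * g 1 0 ≠ 0 := by
    have := g.det_ne_zero
    rwa [Matrix.det_fin_two] at this
  rw [OnePoint.continuous_iff]
  constructor
  · have hinv : Tendsto (fun x : ℝ => x⁻¹) (coclosedCompact ℝ) (𝓝 0) := by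
      rw [coclosedCompact_eq_cocompact, ← Metric.cobounded_eq_cocompact]
      exact tendsto_inv₀_cobounded
    have hne : ∀ᶠ x : ℝ in coclosedCompact ℝ, x ≠ 0 := by
      rw [coclosedCompact_eq_cocompact, ← Metric.cobounded_eq_cocompact]
      exact Bornology.eventually_ne_cobounded 0
    rw [OnePoint.smul_infty_eq_ite]
    have hu : Tendsto (fun x : ℝ => g 0 0 + g 0 1 * x⁻¹) (coclosedCompact ℝ) (𝓝 (g 0 0)) := by
      simpa using tendsto_const_nhds.add (hinv.const_mul (g 0 1))
    have hv : Tendsto (fun x : ℝ => g 1 0 + g 1 1 * x⁻¹) (coclosedCompact ℝ) (𝓝 (g 1 0)) := by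
      simpa using tendsto_const_nhds.add (hinv.const_mul (g 1 1))
    refine (tendsto_quot (fun h0 h1 => hdet (by rw [h0, h1]; ring)) hu hv).congr' ?_
    filter_upwards [hne] with x hx
    rw [OnePoint.smul_some_eq_ite]
    have e0 : g 0 0 * x + g 0 1 = (g 0 0 + g 0 1 * x⁻¹) * x := by field_simp
    have e1 : g 1 0 * x + g 1 1 = (g 1 0 + g 1 1 * x⁻¹) * x := by field_simp
    rw [e0, e1, mul_div_mul_right _ _ hx]
    simp only [mul_eq_zero, hx, or_false]
  · rw [continuous_iff_continuousAt]
    intro x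
    have hu : Tendsto (fun y : ℝ => g 0 0 * y + g 0 1) (𝓝 x) (𝓝 (g 0 0 * x + g 0 1)) :=
      Continuous.tendsto (by fun_prop) x
    have hv : Tendsto (fun y : ℝ => g 1 0 * y + g 1 1) (𝓝 x) (𝓝 (g 1 0 * x + g 1 1)) :=
      Continuous.tendsto (by fun_prop) x
    simp only [ContinuousAt, OnePoint.smul_some_eq_ite]
    refine tendsto_quot (fun h0 h1 => hdet ?_) hu hv
    linear_combination g 0 0 * h0 - g 1 0 * h1

/-- The action of `SL(2, ℝ)` on `ℝ̂` by fractional linear maps `x ↦ (a x + b) / (c x + d)`, as a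
homomorphism into the group of homeomorphisms of `ℝ̂`. -/
noncomputable def moebius : Matrix.SpecialLinearGroup (Fin 2) ℝ →* (RHat ≃ₜ RHat) where
  toFun g :=
    { toEquiv := MulAction.toPerm (Matrix.SpecialLinearGroup.toGL g)
      continuous_toFun := continuous_smul _
      continuous_invFun := continuous_smul _ }
  map_one' := by ext x; simp
  map_mul' g h := by
    ext x
    change Matrix.SpecialLinearGroup.toGL (g * h) • x = _
    rw [map_mul, mul_smul]
    rfl

/-- The group `Möb⁺(ℝ̂)`: the homeomorphisms of `ℝ̂` induced by the isometries
`z ↦ (a z + b) / (c z + d)`, `ad - bc = 1`, of the upper half plane. -/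
noncomputable def mobPlus : Subgroup (RHat ≃ₜ RHat) := moebius.range

/-- `f` is a `k`-quasisymmetric homeomorphism of `ℝ̂`: it preserves orientation and, after
postcomposition with some `m ∈ Möb⁺(ℝ̂)`, it fixes `∞` and restricts to a map `h : ℝ → ℝ` with
`1 / k ≤ (h (x + t) - h x) / (h x - h (x - t)) ≤ k` for all `x` and all `t > 0`.
(The denominators do not vanish, `h` being injective.) -/
def IsQuasisymmetric (k : ℝ) (f : RHat ≃ₜ RHat) : Prop :=
  OrientationPreserving f ∧
    ∃ m ∈ mobPlus, m (f ∞) = ∞ ∧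
      ∃ h : ℝ → ℝ, (∀ x : ℝ, m (f (x : RHat)) = (h x : RHat)) ∧
        ∀ x t : ℝ, 0 < t →
          1 / k ≤ (h (x + t) - h x) / (h x - h (x - t)) ∧
            (h (x + t) - h x) / (h x - h (x - t)) ≤ k

/-- A family of homeomorphisms of `ℝ̂` is uniformly quasisymmetric if all its members are
`k`-quasisymmetric with one and the same constant `k > 0`. -/
def UniformlyQuasisymmetric (F : Set (RHat ≃ₜ RHat)) : Prop :=
  ∃ k : ℝ, 0 < k ∧ ∀ f ∈ F, IsQuasisymmetric k f

/-- Uniform convergence `u n → g` on `s` of self-maps of `ℝ̂`, with respect to the unique uniform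
structure of the compact Hausdorff space `ℝ̂`. -/
def UniformConvOn (u : ℕ → RHat → RHat) (g : RHat → RHat) (s : Set RHat) : Prop :=
  letI : UniformSpace RHat := uniformSpaceOfCompactR1
  TendstoUniformlyOn u g atTop s

/-- The sequence `u` has the attractor-repeller property with attractor `a` and repeller `r`: it
converges to the constant map `a` uniformly outside of any open neighbourhood of `r`. -/
def AttractorRepeller (u : ℕ → (RHat ≃ₜ RHat)) (a r : RHat) : Prop :=
  ∀ U : Set RHat, IsOpen U → r ∈ U → UniformConvOn (fun n x => u n x) (fun _ => a) Uᶜ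

/-- A family of homeomorphisms of `ℝ̂` is a convergence family if its members preserve orientation
and every sequence in it has a subsequence that either converges uniformly to an
orientation preserving homeomorphism, or has the attractor-repeller property. -/
def IsConvergenceFamily (F : Set (RHat ≃ₜ RHat)) : Prop :=
  (∀ f ∈ F, OrientationPreserving f) ∧
    ∀ u : ℕ → (RHat ≃ₜ RHat), (∀ n, u n ∈ F) →
      ∃ φ : ℕ → ℕ, StrictMono φ ∧
        ((∃ g : RHat ≃ₜ RHat, OrientationPreserving g ∧
            UniformConvOn (fun n x => u (φ n) x) (fun x => g x) Set.univ) ∨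
          ∃ a r : RHat, AttractorRepeller (fun n => u (φ n)) a r)

/-- A group of homeomorphisms of `ℝ̂` is a convergence group if it is a convergence family. -/
def IsConvergenceGroup (G : Subgroup (RHat ≃ₜ RHat)) : Prop :=
  IsConvergenceFamily (G : Set (RHat ≃ₜ RHat))

end RHat

namespace RHat

open OnePoint Filter Topology

/-! ### Continuous convergence -/

/-! A `k`-quasisymmetric map factors as a Möbius map after an increasing homeomorphism fixing `0`,
`1`, `∞` (`exists_normalization`), and each factor has its own compactness.

The normalised factors are bounded at every point in terms of `k`, and their defining inequalities
pass to pointwise limits. Those inequalities force strict monotonicity, continuity and surjectivity,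
so every limit is again a homeomorphism (`exists_subseq`).

For the Möbius factors, matrices scaled to norm one subconverge to some `A ≠ 0` with `det A ≥ 0`. If
`det A > 0` the limit is Möbius; if `A` has rank one, the maps tend to its image point away from its
kernel point (`moebius_subseq`).

Joint convergence `ConvAt` composes point by point, so the two limits combine, with the repeller
pulled back by the limit homeomorphism; compactness makes the result uniform. Möbius maps are
themselves `1`-quasisymmetric. -/

/-- Continuous convergence at a point: `u n y → z` as `n → ∞` and `y → x` jointly. -/
def ConvAt (u : ℕ → RHat → RHat) (x z : RHat) : Prop :=
  Tendsto (fun p : ℕ × RHat => u p.1 p.2) (atTop ×ˢ 𝓝 x) (𝓝 z)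

theorem ConvAt.comp {u v : ℕ → RHat → RHat} {x y z : RHat} (hv : ConvAt v y z)
    (hu : ConvAt u x y) : ConvAt (fun n w => v n (u n w)) x z :=
  Tendsto.comp (g := fun p : ℕ × RHat => v p.1 p.2) hv (tendsto_fst.prodMk hu)

theorem ConvAt.subseq {u : ℕ → RHat → RHat} {x z : RHat} (hu : ConvAt u x z) {φ : ℕ → ℕ}
    (hφ : StrictMono φ) : ConvAt (fun n => u (φ n)) x z :=
  Tendsto.comp (g := fun p : ℕ × RHat => u p.1 p.2) hu
    ((hφ.tendsto_atTop.comp tendsto_fst).prodMk tendsto_snd)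

/-- Continuous convergence on a compact set is uniform. -/
theorem uniformConvOn_of_convAt {u : ℕ → RHat → RHat} {g : RHat → RHat} {s : Set RHat}
    (hs : IsCompact s) (hg : Continuous g) (h : ∀ x ∈ s, ConvAt u x (g x)) :
    UniformConvOn u g s := by
  let : UniformSpace RHat := uniformSpaceOfCompactR1
  change TendstoUniformlyOn u g atTop s
  rw [← tendstoLocallyUniformlyOn_iff_tendstoUniformlyOn_of_compact hs,
    tendstoLocallyUniformlyOn_iff_forall_tendsto]
  intro x hx
  have h1 : Tendsto (fun p : ℕ × RHat => (g p.2, u p.1 p.2)) (atTop ×ˢ 𝓝 x)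
      (𝓝 (g x) ×ˢ 𝓝 (g x)) := ((hg.tendsto x).comp tendsto_snd).prodMk (h x hx)
  have h2 : 𝓝 (g x) ×ˢ 𝓝 (g x) ≤ uniformity RHat := by
    rw [← nhds_prod_eq]
    exact nhds_le_uniformity _
  exact (h1.mono_left (Filter.prod_mono le_rfl nhdsWithin_le_nhds)).mono_right h2

/-! ### Homogeneous coordinates and fractional linear maps -/

/-- The point of `ℝ̂` with homogeneous coordinates `(p, q)`. -/
noncomputable def pt (p q : ℝ) : RHat := if q = 0 then ∞ else ((p / q : ℝ) : RHat)

theorem pt_mul {c : ℝ} (hc : c ≠ 0) (p q : ℝ) : pt (c * p) (c * q) = pt p q := by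
  simp [pt, hc, mul_div_mul_left]

theorem moebius_coe (g : Matrix.SpecialLinearGroup (Fin 2) ℝ) (x : ℝ) :
    moebius g (x : RHat) = pt (g 0 0 * x + g 0 1) (g 1 0 * x + g 1 1) :=
  OnePoint.smul_some_eq_ite

theorem moebius_infty (g : Matrix.SpecialLinearGroup (Fin 2) ℝ) :
    moebius g ∞ = pt (g 0 0) (g 1 0) :=
  OnePoint.smul_infty_eq_ite _

theorem det_entries (g : Matrix.SpecialLinearGroup (Fin 2) ℝ) :
    g 0 0 * g 1 1 - g 0 1 * g 1 0 = 1 := by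
  have := g.det_coe
  rwa [Matrix.det_fin_two] at this

/-! ### Cyclic order through determinants -/

/-- First homogeneous coordinate. -/
def num : RHat → ℝ
  | .some x => x
  | .infty => 1

/-- Second homogeneous coordinate. -/
def den : RHat → ℝ
  | .some _ => 1
  | .infty => 0

@[simp] theorem num_coe (x : ℝ) : num (x : RHat) = x := rfl
@[simp] theorem den_coe (x : ℝ) : den (x : RHat) = 1 := rfl
@[simp] theorem num_infty : num ∞ = 1 := rfl
@[simp] theorem den_infty : den ∞ = 0 := rfl

theorem moebius_eq_pt (g : Matrix.SpecialLinearGroup (Fin 2) ℝ) (x : RHat) :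
    moebius g x = pt (g 0 0 * num x + g 0 1 * den x) (g 1 0 * num x + g 1 1 * den x) := by
  induction x using OnePoint.rec with
  | infty => simp [moebius_infty]
  | coe x => simp [moebius_coe]

theorem exists_scale_pt {p q : ℝ} (h : q = 0 → p ≠ 0) :
    ∃ c : ℝ, c ≠ 0 ∧ num (pt p q) = c * p ∧ den (pt p q) = c * q := by
  by_cases hq : q = 0
  · exact ⟨p⁻¹, inv_ne_zero (h hq), by simp [pt, hq, h hq], by simp [pt, hq]⟩
  · exact ⟨q⁻¹, inv_ne_zero hq, by simp [pt, hq]; ring, by simp [pt, hq]⟩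

theorem num_ne_zero {x : RHat} (h : den x = 0) : num x ≠ 0 := by
  induction x using OnePoint.rec with
  | infty => simp
  | coe x => simp at h

/-- The determinant of the homogeneous coordinates of two points. -/
def bracket (a b : RHat) : ℝ := num a * den b - den a * num b

/-- Each point enters two of the three brackets, so rescaling its coordinates multiplies the product
by a square. The sign is thus intrinsic, and determinant-one matrices preserve it. -/
theorem cyc_iff (a b c : RHat) : Cyc a b c ↔ 0 < bracket a b * bracket b c * bracket c a := by
  induction a using OnePoint.rec with
  | infty =>
    induction b using OnePoint.rec with
    | infty => simp [bracket, Cyc]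
    | coe b =>
      induction c using OnePoint.rec with
      | infty => simp [bracket, Cyc]
      | coe c => simp [bracket, Cyc]
  | coe a =>
    induction b using OnePoint.rec with
    | infty =>
      induction c using OnePoint.rec with
      | infty => simp [bracket, Cyc]
      | coe c => simp [bracket, Cyc]
    | coe b =>
      induction c using OnePoint.rec with
      | infty => simp [bracket, Cyc]
      | coe c =>
        simp only [bracket, Cyc, num_coe, den_coe, mul_one, one_mul]
        constructor
        · rintro (⟨h1, h2⟩ | ⟨h1, h2⟩ | ⟨h1, h2⟩)
          · exact mul_pos (mul_pos_of_neg_of_neg (by linarith) (by linarith)) (by linarith)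
          · exact mul_pos_of_neg_of_neg (mul_neg_of_pos_of_neg (by linarith) (by linarith))
              (by linarith)
          · exact mul_pos_of_neg_of_neg (mul_neg_of_neg_of_pos (by linarith) (by linarith))
              (by linarith)
        · intro h
          rcases lt_trichotomy a b with h1 | h1 | h1
          · rcases lt_trichotomy b c with h2 | h2 | h2
            · exact Or.inl ⟨h1, h2⟩
            · simp [h2] at h
            · rcases lt_trichotomy c a with h3 | h3 | h3
              · exact Or.inr (Or.inr ⟨h3, h1⟩)
              · simp [h3] at h
              · have : (a - b) * (b - c) < 0 := mul_neg_of_neg_of_pos (by linarith) (by linarith)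
                nlinarith
          · simp [h1] at h
          · rcases lt_trichotomy b c with h2 | h2 | h2
            · rcases lt_trichotomy c a with h3 | h3 | h3
              · exact Or.inr (Or.inl ⟨h2, h3⟩)
              · simp [h3] at h
              · have : (a - b) * (b - c) < 0 := mul_neg_of_pos_of_neg (by linarith) (by linarith)
                nlinarith
            · simp [h2] at h
            · have : 0 < (a - b) * (b - c) := mul_pos (by linarith) (by linarith)
              nlinarith

theorem orientationPreserving_moebius (g : Matrix.SpecialLinearGroup (Fin 2) ℝ) :
    OrientationPreserving (moebius g) := by
  have hdet := det_entries g
  have key (x : RHat) : ∃ c : ℝ, c ≠ 0 ∧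
      num (moebius g x) = c * (g 0 0 * num x + g 0 1 * den x) ∧
      den (moebius g x) = c * (g 1 0 * num x + g 1 1 * den x) := by
    rw [moebius_eq_pt]
    refine exists_scale_pt fun h0 h1 => ?_
    have hn : num x = 0 := by linear_combination g 1 1 * h1 - g 0 1 * h0 - num x * hdet
    have hd : den x = 0 := by linear_combination g 0 0 * h0 - g 1 0 * h1 - den x * hdet
    exact num_ne_zero hd hn
  intro x y z h
  rw [cyc_iff] at h ⊢
  obtain ⟨a, ha, ha1, ha2⟩ := key x
  obtain ⟨b, hb, hb1, hb2⟩ := key y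
  obtain ⟨c, hc, hc1, hc2⟩ := key z
  have e1 : bracket (moebius g x) (moebius g y) = a * b * bracket x y := by
    simp only [bracket, ha1, ha2, hb1, hb2]
    linear_combination a * b * (num x * den y - den x * num y) * hdet
  have e2 : bracket (moebius g y) (moebius g z) = b * c * bracket y z := by
    simp only [bracket, hc1, hc2, hb1, hb2]
    linear_combination b * c * (num y * den z - den y * num z) * hdet
  have e3 : bracket (moebius g z) (moebius g x) = c * a * bracket z x := by
    simp only [bracket, hc1, hc2, ha1, ha2]
    linear_combination c * a * (num z * den x - den z * num x) * hdet
  have e : bracket (moebius g x) (moebius g y) * bracket (moebius g y) (moebius g z) *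
      bracket (moebius g z) (moebius g x) =
      (a * b * c) ^ 2 * (bracket x y * bracket y z * bracket z x) := by
    rw [e1, e2, e3]; ring
  rw [e]
  positivity

theorem OrientationPreserving.mul {f g : RHat ≃ₜ RHat} (hf : OrientationPreserving f)
    (hg : OrientationPreserving g) : OrientationPreserving (f * g) :=
  fun a b c h => hf _ _ _ (hg a b c h)

/-! ### Limits of sequences of Möbius maps -/

/-- The quarter turn `x ↦ -1 / x`. -/
def quarterTurn : Matrix.SpecialLinearGroup (Fin 2) ℝ :=
  ⟨!![0, -1; 1, 0], by simp [Matrix.det_fin_two]⟩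

/-- Matrices matter only up to the scalars `c n`, and the limit `A` may be singular: it suffices
that `A` does not kill the vector `(x, 1)`. -/
theorem convAt_moebius_coe {g : ℕ → Matrix.SpecialLinearGroup (Fin 2) ℝ} {c : ℕ → ℝ}
    (hc : ∀ n, c n ≠ 0) {A : Fin 2 → Fin 2 → ℝ}
    (hA : ∀ i j, Tendsto (fun n => c n * g n i j) atTop (𝓝 (A i j))) {x : ℝ}
    (hx : A 1 0 * x + A 1 1 = 0 → A 0 0 * x + A 0 1 ≠ 0) :
    ConvAt (fun n => moebius (g n)) x (pt (A 0 0 * x + A 0 1) (A 1 0 * x + A 1 1)) := by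
  have h (i : Fin 2) : Tendsto (fun p : ℕ × ℝ => c p.1 * g p.1 i 0 * p.2 + c p.1 * g p.1 i 1)
      (atTop ×ˢ 𝓝 x) (𝓝 (A i 0 * x + A i 1)) :=
    (((hA i 0).comp tendsto_fst).mul tendsto_snd).add ((hA i 1).comp tendsto_fst)
  have h2 := tendsto_quot hx (h 0) (h 1)
  unfold ConvAt
  rw [OnePoint.nhds_coe_eq, ← Filter.map_id (f := (atTop : Filter ℕ)), Filter.prod_map_map_eq,
    tendsto_map'_iff]
  refine h2.congr fun p => ?_
  change _ = moebius (g p.1) (p.2 : RHat)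
  rw [moebius_coe, ← pt_mul (hc p.1)]
  simp only [pt, mul_add, mul_assoc]

theorem convAt_moebius_infty {g : ℕ → Matrix.SpecialLinearGroup (Fin 2) ℝ} {c : ℕ → ℝ}
    (hc : ∀ n, c n ≠ 0) {A : Fin 2 → Fin 2 → ℝ}
    (hA : ∀ i j, Tendsto (fun n => c n * g n i j) atTop (𝓝 (A i j)))
    (hx : A 1 0 = 0 → A 0 0 ≠ 0) :
    ConvAt (fun n => moebius (g n)) ∞ (pt (A 0 0) (A 1 0)) := by
  -- The quarter turn carries `∞` to `0`; composing with its inverse on the right swaps the columns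
  -- up to sign and reduces to the finite case.
  have e (n : ℕ) (i : Fin 2) :
      (g n * quarterTurn⁻¹) i 0 = - g n i 1 ∧ (g n * quarterTurn⁻¹) i 1 = g n i 0 := by
    rw [Matrix.SpecialLinearGroup.coe_mul, Matrix.SpecialLinearGroup.coe_inv,
      Matrix.adjugate_fin_two]
    simp [quarterTurn, Matrix.mul_apply]
  have h := convAt_moebius_coe (g := fun n => g n * quarterTurn⁻¹) hc
    (A := fun i => ![-A i 1, A i 0]) (x := 0) (fun i j => by
      fin_cases j
      · simpa [e] using (hA i 1).neg
      · simpa [e] using hA i 0) (by simpa using hx)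
  have h0 : ConvAt (fun _ => moebius quarterTurn) ∞ ((0 : ℝ) : RHat) := by
    have e0 : moebius quarterTurn ∞ = ((0 : ℝ) : RHat) := by
      rw [moebius_infty]; simp [quarterTurn, pt]
    rw [← e0]
    exact ((moebius quarterTurn).continuous.tendsto ∞).comp tendsto_snd
  have h1 := h.comp h0
  simp only [map_mul, map_inv] at h1
  simpa using h1

/-- A sequence of Moebius maps has a subsequence that converges to a Moebius map, or to a constant
away from one point. -/
theorem moebius_subseq (g : ℕ → Matrix.SpecialLinearGroup (Fin 2) ℝ) :
    ∃ φ : ℕ → ℕ, StrictMono φ ∧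
      ((∃ m : Matrix.SpecialLinearGroup (Fin 2) ℝ,
          ∀ x, ConvAt (fun n => moebius (g (φ n))) x (moebius m x)) ∨
        ∃ a r : RHat, ∀ x, x ≠ r → ConvAt (fun n => moebius (g (φ n))) x a) := by
  let M : ℕ → Fin 2 → Fin 2 → ℝ := fun n i j => g n i j
  have hM0 (n : ℕ) : M n ≠ 0 := fun h => by
    have := det_entries (g n)
    have h' (i j) : g n i j = 0 := congrFun (congrFun h i) j
    simp [h'] at this
  have hc (n : ℕ) : ‖M n‖⁻¹ ≠ 0 := inv_ne_zero (norm_ne_zero_iff.2 (hM0 n))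
  obtain ⟨A, hA1, φ, hφ, hA⟩ := (isCompact_sphere (0 : Fin 2 → Fin 2 → ℝ) 1).tendsto_subseq
    (x := fun n => ‖M n‖⁻¹ • M n) fun n => by
      simp [norm_smul, norm_ne_zero_iff.2 (hM0 n)]
  have hA0 : A ≠ 0 := by
    rintro rfl
    simp at hA1
  have hlim (i j : Fin 2) :
      Tendsto (fun n => ‖M (φ n)‖⁻¹ * g (φ n) i j) atTop (𝓝 (A i j)) :=
    tendsto_pi_nhds.1 (tendsto_pi_nhds.1 hA i) j
  -- The rescaled matrices have determinant `‖M‖⁻¹ ^ 2`.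
  have hdet : 0 ≤ A 0 0 * A 1 1 - A 0 1 * A 1 0 := by
    refine ge_of_tendsto' (((hlim 0 0).mul (hlim 1 1)).sub ((hlim 0 1).mul (hlim 1 0))) fun n => ?_
    have := det_entries (g (φ n))
    have e : ‖M (φ n)‖⁻¹ * g (φ n) 0 0 * (‖M (φ n)‖⁻¹ * g (φ n) 1 1) -
      ‖M (φ n)‖⁻¹ * g (φ n) 0 1 * (‖M (φ n)‖⁻¹ * g (φ n) 1 0) = ‖M (φ n)‖⁻¹ ^ 2 := by
      linear_combination ‖M (φ n)‖⁻¹ ^ 2 * this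
    rw [e]
    positivity
  refine ⟨φ, hφ, ?_⟩
  rcases hdet.lt_or_eq with hd | hd
  · left
    set d := A 0 0 * A 1 1 - A 0 1 * A 1 0 with hddef
    have hs : √d ≠ 0 := (Real.sqrt_pos.2 hd).ne'
    let B : Fin 2 → Fin 2 → ℝ := fun i j => (√d)⁻¹ * A i j
    have hB : B 0 0 * B 1 1 - B 0 1 * B 1 0 = 1 := by
      have h1 : (√d)⁻¹ ^ 2 * d = 1 := by
        rw [inv_pow, Real.sq_sqrt hd.le, inv_mul_cancel₀ hd.ne']
      linear_combination h1 + (√d)⁻¹ ^ 2 * hddef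
    have hlimB (i j : Fin 2) :
        Tendsto (fun n => ((√d)⁻¹ * ‖M (φ n)‖⁻¹) * g (φ n) i j) atTop (𝓝 (B i j)) := by
      simpa only [mul_assoc] using (hlim i j).const_mul (√d)⁻¹
    have hcB (n : ℕ) : (√d)⁻¹ * ‖M (φ n)‖⁻¹ ≠ 0 := mul_ne_zero (inv_ne_zero hs) (hc _)
    obtain ⟨m, hm⟩ : ∃ m : Matrix.SpecialLinearGroup (Fin 2) ℝ, ∀ i j, m i j = B i j :=
      ⟨⟨Matrix.of B, by rw [Matrix.det_fin_two]; exact hB⟩, fun _ _ => rfl⟩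
    refine ⟨m, fun x => ?_⟩
    induction x using OnePoint.rec with
    | infty =>
      rw [moebius_infty, hm, hm]
      refine convAt_moebius_infty hcB hlimB fun h0 h1 => ?_
      simp [h0, h1] at hB
    | coe x =>
      rw [moebius_coe, hm, hm, hm, hm]
      refine convAt_moebius_coe hcB hlimB fun h0 h1 => ?_
      have : (0 : ℝ) = 1 := by linear_combination hB - B 0 0 * h0 + B 1 0 * h1
      exact zero_ne_one this
  · right
    -- Rank one: `A` is the column `(α, β)` times the row `(γ, δ)`. Its image gives the attractor
    -- `pt α β`, its kernel the repeller `pt (-δ) γ`.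
    obtain ⟨α, β, γ, δ, hαβ, hγδ, h00, h01, h10, h11⟩ : ∃ α β γ δ : ℝ, (β = 0 → α ≠ 0) ∧
        (γ = 0 → δ ≠ 0) ∧ A 0 0 = α * γ ∧ A 0 1 = α * δ ∧ A 1 0 = β * γ ∧ A 1 1 = β * δ := by
      by_cases h0 : A 0 0 = 0 ∧ A 0 1 = 0
      · refine ⟨0, 1, A 1 0, A 1 1, by simp, fun h1 h2 => hA0 ?_, by simp [h0.1], by simp [h0.2],
          by simp, by simp⟩
        ext i j
        fin_cases i <;> fin_cases j <;> simp [h0.1, h0.2, h1, h2]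
      · by_cases h1 : A 0 0 = 0
        · have h2 : A 0 1 ≠ 0 := fun h => h0 ⟨h1, h⟩
          have h3 : A 1 0 = 0 := by
            have : A 0 1 * A 1 0 = 0 := by rw [h1] at hd; linarith
            exact (mul_eq_zero.1 this).resolve_left h2
          exact ⟨1, A 1 1 / A 0 1, A 0 0, A 0 1, by simp, fun _ => h2, by simp, by simp,
            by simp [h1, h3], by field_simp⟩
        · refine ⟨1, A 1 0 / A 0 0, A 0 0, A 0 1, by simp, fun h => absurd h h1, by simp, by simp,
            by field_simp, ?_⟩
          field_simp
          linarith
    refine ⟨pt α β, pt (-δ) γ, fun x hx => ?_⟩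
    induction x using OnePoint.rec with
    | infty =>
      have hγ : γ ≠ 0 := by
        rintro rfl
        simp [pt] at hx
      have e : pt (A 0 0) (A 1 0) = pt α β := by
        rw [h00, h10, mul_comm α, mul_comm β, pt_mul hγ]
      rw [← e]
      refine convAt_moebius_infty (fun n => hc _) hlim ?_
      rw [h00, h10]
      simpa [hγ] using hαβ
    | coe x =>
      have hγ : γ * x + δ ≠ 0 := by
        intro h
        have hγ0 : γ ≠ 0 := fun h0 => hγδ h0 (by simpa [h0] using h)
        refine hx ?_
        simp only [pt, hγ0, if_false]
        congr 1
        field_simp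
        linarith
      have e0 : A 0 0 * x + A 0 1 = (γ * x + δ) * α := by rw [h00, h01]; ring
      have e1 : A 1 0 * x + A 1 1 = (γ * x + δ) * β := by rw [h10, h11]; ring
      have e : pt (A 0 0 * x + A 0 1) (A 1 0 * x + A 1 1) = pt α β := by
        rw [e0, e1, pt_mul hγ]
      rw [← e]
      refine convAt_moebius_coe (fun n => hc _) hlim ?_
      rw [e0, e1]
      simpa [hγ] using hαβ

/-! ### Normalised quasisymmetric functions -/

/-- Increasing functions that fix `0` and `1` and are quasisymmetric with constant `k`. -/
structure IsNormalizedQS (k : ℝ) (h : ℝ → ℝ) : Prop where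
  -- Weak monotonicity and cleared denominators keep every condition closed under pointwise limits;
  -- strictness is recovered in `strictMono`.
  mono : Monotone h
  zero : h 0 = 0
  one : h 1 = 1
  right_le : ∀ x t : ℝ, 0 < t → h (x + t) - h x ≤ k * (h x - h (x - t))
  left_le : ∀ x t : ℝ, 0 < t → h x - h (x - t) ≤ k * (h (x + t) - h x)

namespace IsNormalizedQS

variable {k : ℝ} {h : ℝ → ℝ}

/-- Conjugation by `x ↦ 1 - x` swaps `0` with `1` and the two inequalities, so one-sided results
transfer to the other side. -/
theorem reflect (hh : IsNormalizedQS k h) : IsNormalizedQS k fun x => 1 - h (1 - x) where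
  mono x y hxy := by
    have := hh.mono (show 1 - y ≤ 1 - x by linarith)
    change 1 - h (1 - x) ≤ 1 - h (1 - y)
    linarith
  zero := by simp [hh.one]
  one := by simp [hh.zero]
  right_le x t ht := by
    have := hh.left_le (1 - x) t ht
    rw [show 1 - (x + t) = 1 - x - t by ring, show 1 - (x - t) = 1 - x + t by ring]
    linarith
  left_le x t ht := by
    have := hh.right_le (1 - x) t ht
    rw [show 1 - (x + t) = 1 - x - t by ring, show 1 - (x - t) = 1 - x + t by ring]
    linarith

theorem nonneg (hh : IsNormalizedQS k h) : 0 ≤ k := by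
  have h1 := hh.left_le 1 1 one_pos
  have h2 := hh.mono (show (1 : ℝ) ≤ 1 + 1 by norm_num)
  simp only [sub_self, hh.zero, hh.one, sub_zero] at h1 h2
  by_contra hk
  nlinarith

theorem natCast_le (hh : IsNormalizedQS k h) (n : ℕ) : h n ≤ (1 + k) ^ n := by
  have hk := hh.nonneg
  induction n with
  | zero => simp [hh.zero]
  | succ n ih =>
    -- The recursion `h (n + 1) ≤ (1 + k) * h n` needs `h (n - 1) ≥ 0`, hence starts at `n = 1`.
    rcases n with _ | n
    · simp [hh.one, hk]
    · have h1 := hh.right_le ((n + 1 : ℕ) : ℝ) 1 one_pos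
      have h2 : 0 ≤ h (((n + 1 : ℕ) : ℝ) - 1) := by
        rw [← hh.zero]
        exact hh.mono (by push_cast; linarith [(Nat.cast_nonneg n : (0 : ℝ) ≤ n)])
      have h3 : h ((n + 1 + 1 : ℕ) : ℝ) ≤ (1 + k) * h ((n + 1 : ℕ) : ℝ) := by
        rw [Nat.cast_succ (n + 1)]
        nlinarith
      calc _ ≤ _ := h3
        _ ≤ (1 + k) * (1 + k) ^ (n + 1) := by gcongr
        _ = _ := by ring

/-- Normalised quasisymmetric functions are bounded at every point, uniformly. -/
theorem exists_bound (k x : ℝ) :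
    ∃ C : ℝ, ∀ h : ℝ → ℝ, IsNormalizedQS k h → h x ∈ Set.Icc (-C) C := by
  obtain ⟨n, hn⟩ := exists_nat_ge x
  obtain ⟨m, hm⟩ := exists_nat_ge (1 - x)
  refine ⟨max ((1 + k) ^ n) ((1 + k) ^ m), fun h hh => ⟨?_, ?_⟩⟩
  · have h1 := hh.reflect.natCast_le m
    have h2 := hh.mono (show 1 - (m : ℝ) ≤ x by linarith)
    have := le_max_right ((1 + k) ^ n) ((1 + k) ^ m)
    linarith
  · exact (hh.mono hn).trans ((hh.natCast_le n).trans (le_max_left _ _))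

/-- If `h a = h b`, quasisymmetry spreads the flat interval by its own length on both sides, again
and again, until it contains `0` and `1`, where `h` differs. -/
theorem strictMono (hh : IsNormalizedQS k h) : StrictMono h := by
  refine hh.mono.strictMono_of_injective ?_
  suffices H : ∀ a b, a < b → h a ≠ h b by
    intro a b hab
    by_contra hne
    rcases lt_or_gt_of_ne hne with h1 | h1
    · exact H a b h1 hab
    · exact H b a h1 hab.symm
  intro a b hlt hab
  have ht : 0 < b - a := sub_pos.2 hlt
  have key (n : ℕ) : h (a - n * (b - a)) = h a ∧ h (b + n * (b - a)) = h a := by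
    induction n with
    | zero => simp [hab]
    | succ n ih =>
      have hn : 0 ≤ n * (b - a) := by positivity
      constructor
      · have e0 : h (a - n * (b - a) + (b - a)) = h a := by
          apply le_antisymm
          · rw [hab]; exact hh.mono (by linarith)
          · rw [← ih.1]; exact hh.mono (by linarith)
        have h1 := hh.left_le (a - n * (b - a)) (b - a) ht
        rw [e0, ih.1, sub_self, mul_zero] at h1
        rw [show a - (n + 1 : ℕ) * (b - a) = a - n * (b - a) - (b - a) by push_cast; ring]
        exact le_antisymm (hh.mono (by linarith)) (by linarith)
      · have e0 : h (b + n * (b - a) - (b - a)) = h a := by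
          apply le_antisymm
          · rw [← ih.2]; exact hh.mono (by linarith)
          · exact hh.mono (by linarith)
        have h1 := hh.right_le (b + n * (b - a)) (b - a) ht
        rw [e0, ih.2, sub_self, mul_zero] at h1
        rw [show b + (n + 1 : ℕ) * (b - a) = b + n * (b - a) + (b - a) by push_cast; ring]
        exact le_antisymm (by linarith) (hh.mono (by linarith))
  obtain ⟨n, hn⟩ := exists_nat_ge (max a (1 - b) / (b - a))
  rw [div_le_iff₀ ht, max_le_iff] at hn
  have h0 := hh.mono (show a - n * (b - a) ≤ 0 by linarith)
  have h1 := hh.mono (show 1 ≤ b + n * (b - a) by linarith)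
  rw [(key n).1, hh.zero] at h0
  rw [(key n).2, hh.one] at h1
  linarith

/-- With a finite limit, `h t ≤ k * (h (2 * t) - h t)` would tend to `0` on the right, while `h t ≥
1` for `t ≥ 1`. -/
theorem tendsto_atTop (hh : IsNormalizedQS k h) : Tendsto h atTop atTop := by
  rcases tendsto_atTop_of_monotone hh.mono with H | ⟨l, hl⟩
  · exact H
  · exfalso
    have h2 : Tendsto (fun t : ℝ => h (t + t)) atTop (𝓝 l) :=
      hl.comp (tendsto_id.atTop_add_atTop tendsto_id)
    have h3 : Tendsto (fun t : ℝ => k * (h (t + t) - h t)) atTop (𝓝 (k * (l - l))) :=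
      (h2.sub hl).const_mul k
    have h4 : (1 : ℝ) ≤ k * (l - l) := by
      refine ge_of_tendsto h3 ?_
      filter_upwards [eventually_ge_atTop (1 : ℝ)] with t ht
      have h5 := hh.left_le t t (by linarith)
      have h6 := hh.mono ht
      rw [sub_self, hh.zero, sub_zero] at h5
      rw [hh.one] at h6
      linarith
    simp only [sub_self, mul_zero] at h4
    linarith

theorem tendsto_atBot (hh : IsNormalizedQS k h) : Tendsto h atBot atBot := by
  have h1 : Tendsto (fun x => 1 - h (1 - x)) atTop atTop := hh.reflect.tendsto_atTop
  have h2 : Tendsto (fun x : ℝ => 1 - x) atBot atTop :=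
    tendsto_atTop_add_const_left _ 1 tendsto_neg_atBot_atTop
  have h3 : Tendsto (fun x : ℝ => -(1 - h (1 - (1 - x)))) atBot atBot :=
    tendsto_neg_atTop_atBot.comp (h1.comp h2)
  refine (tendsto_atBot_add_const_left _ 1 h3).congr fun x => ?_
  simp

/-- A jump at `x` would be at most `k` times the limit of `h (x + 2 * t) - h (x + t)`, which is `0`.
-/
theorem continuousWithinAt_Ioi (hh : IsNormalizedQS k h) (x : ℝ) :
    ContinuousWithinAt h (Set.Ioi x) x := by
  have hlim := hh.mono.tendsto_nhdsGT x
  set R := sInf (h '' Set.Ioi x)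
  have aux (c : ℝ) (hc : 0 < c) : Tendsto (fun t => h (x + c * t)) (𝓝[>] 0) (𝓝 R) := by
    refine hlim.comp (tendsto_nhdsWithin_iff.2 ⟨?_, ?_⟩)
    · have : Tendsto (fun t : ℝ => x + c * t) (𝓝 0) (𝓝 (x + c * 0)) :=
        Continuous.tendsto (by fun_prop) 0
      rw [mul_zero, add_zero] at this
      exact this.mono_left nhdsWithin_le_nhds
    · filter_upwards [self_mem_nhdsWithin] with t ht
      have : 0 < c * t := mul_pos hc ht
      simpa using this
  have h1 := (aux 1 one_pos).sub_const (h x)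
  have h2 := ((aux 2 two_pos).sub (aux 1 one_pos)).const_mul k
  have h3 : R - h x ≤ k * (R - R) := by
    refine le_of_tendsto_of_tendsto h1 h2 ?_
    filter_upwards [self_mem_nhdsWithin] with t ht
    have := hh.left_le (x + t) t ht
    rw [add_sub_cancel_right, show x + t + t = x + 2 * t by ring] at this
    simpa using this
  have h4 : h x ≤ R := by
    refine ge_of_tendsto hlim ?_
    filter_upwards [self_mem_nhdsWithin] with t ht
    exact hh.mono (le_of_lt ht)
  have h5 : R = h x := by
    rw [sub_self, mul_zero] at h3
    linarith
  rw [h5] at hlim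
  exact hlim

theorem continuous (hh : IsNormalizedQS k h) : Continuous h := by
  rw [continuous_iff_continuousAt]
  intro x
  rw [continuousAt_iff_continuous_left'_right']
  refine ⟨?_, hh.continuousWithinAt_Ioi x⟩
  have h1 : Tendsto (fun y : ℝ => 1 - y) (𝓝[<] x) (𝓝[>] (1 - x)) := by
    refine tendsto_nhdsWithin_iff.2
      ⟨(Continuous.tendsto (by fun_prop) x).mono_left nhdsWithin_le_nhds, ?_⟩
    filter_upwards [self_mem_nhdsWithin] with t ht
    simpa using ht
  have h2 := (Tendsto.comp (hh.reflect.continuousWithinAt_Ioi (1 - x)) h1).const_sub 1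
  simpa [ContinuousWithinAt, Function.comp_def] using h2

theorem surjective (hh : IsNormalizedQS k h) : Function.Surjective h :=
  hh.continuous.surjective hh.tendsto_atTop hh.tendsto_atBot

/-- The homeomorphism of `ℝ̂` extending a normalised quasisymmetric function. -/
noncomputable def homeo (hh : IsNormalizedQS k h) : RHat ≃ₜ RHat :=
  (hh.strictMono.orderIsoOfSurjective h hh.surjective).toHomeomorph.onePointCongr

theorem homeo_coe (hh : IsNormalizedQS k h) (x : ℝ) : hh.homeo (x : RHat) = (h x : RHat) := rfl

theorem homeo_infty (hh : IsNormalizedQS k h) : hh.homeo ∞ = ∞ := rfl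

theorem orientationPreserving_homeo (hh : IsNormalizedQS k h) :
    OrientationPreserving hh.homeo := by
  intro a b c
  induction a using OnePoint.rec <;> induction b using OnePoint.rec <;>
    induction c using OnePoint.rec <;>
    simp [homeo_coe, homeo_infty, Cyc, hh.strictMono.lt_iff_lt]

/-- Pointwise limits along a nontrivial filter preserve normalised quasisymmetry. -/
theorem of_tendsto {ι : Type*} {l : Filter ι} [l.NeBot] {u : ι → ℝ → ℝ} {H : ℝ → ℝ}
    (hu : ∀ i, IsNormalizedQS k (u i)) (hH : ∀ x, Tendsto (fun i => u i x) l (𝓝 (H x))) :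
    IsNormalizedQS k H where
  mono x y hxy := le_of_tendsto_of_tendsto' (hH x) (hH y) fun i => (hu i).mono hxy
  zero := tendsto_nhds_unique (hH 0) (by simp [(hu _).zero])
  one := tendsto_nhds_unique (hH 1) (by simp [(hu _).one])
  right_le x t ht := le_of_tendsto_of_tendsto' ((hH _).sub (hH _))
    (((hH _).sub (hH _)).const_mul k) fun i => (hu i).right_le x t ht
  left_le x t ht := le_of_tendsto_of_tendsto' ((hH _).sub (hH _))
    (((hH _).sub (hH _)).const_mul k) fun i => (hu i).left_le x t ht

/-- Convergence on the rationals of increasing functions to a normalised quasisymmetric function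
gives continuous convergence of the extensions to `ℝ̂`. -/
theorem convAt_homeo {u : ℕ → ℝ → ℝ} (hu : ∀ n, IsNormalizedQS k (u n))
    (hh : IsNormalizedQS k h)
    (hlim : ∀ q : ℚ, Tendsto (fun n => u n q) atTop (𝓝 (h q))) (x : RHat) :
    ConvAt (fun n => (hu n).homeo) x (hh.homeo x) := by
  unfold ConvAt
  induction x using OnePoint.rec with
  | infty =>
    rw [homeo_infty, OnePoint.hasBasis_nhds_infty.tendsto_right_iff]
    rintro K ⟨-, hK⟩
    obtain ⟨B, hB⟩ := hK.isBounded.subset_closedBall 0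
    obtain ⟨y, hy⟩ := (hh.tendsto_atTop.eventually_gt_atTop B).exists
    obtain ⟨z, hz⟩ := (hh.tendsto_atBot.eventually_lt_atBot (-B)).exists
    obtain ⟨q, hq⟩ := exists_rat_gt y
    obtain ⟨r, hr⟩ := exists_rat_lt z
    have hV : ((↑) '' Set.Icc (r : ℝ) q : Set RHat)ᶜ ∈ 𝓝 (∞ : RHat) :=
      (OnePoint.isOpen_compl_image_coe.2 ⟨isClosed_Icc, isCompact_Icc⟩).mem_nhds (by simp)
    -- By monotonicity, control at `r` and `q` alone keeps `u n` out of `[-B, B]` off `[r, q]`.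
    filter_upwards [(((hlim q).eventually (eventually_gt_nhds (hy.trans (hh.strictMono hq)))).and
      ((hlim r).eventually (eventually_lt_nhds ((hh.strictMono hr).trans hz)))).prod_mk hV]
      with ⟨n, x⟩ ⟨⟨h1, h2⟩, h3⟩
    induction x using OnePoint.rec with
    | infty => exact Or.inr rfl
    | coe x =>
      refine Or.inl ⟨u n x, fun hx => h3 ⟨x, ?_, rfl⟩, rfl⟩
      have h4 := hB hx
      rw [mem_closedBall_zero_iff, Real.norm_eq_abs, abs_le] at h4
      constructor
      · by_contra hlt
        linarith [(hu n).mono (not_le.1 hlt).le, h4.1]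
      · by_contra hlt
        linarith [(hu n).mono (not_le.1 hlt).le, h4.2]
  | coe x =>
    rw [homeo_coe, OnePoint.nhds_coe_eq, ← Filter.map_id (f := (atTop : Filter ℕ)),
      Filter.prod_map_map_eq, tendsto_map'_iff]
    refine (OnePoint.continuous_coe.tendsto (h x)).comp
      (f := fun p : ℕ × ℝ => u p.1 p.2) ?_
    rw [tendsto_order]
    constructor
    · intro a ha
      obtain ⟨q, hq, hqx⟩ : ∃ q : ℚ, a < h q ∧ (q : ℝ) < x := by
        have h1 := (hh.continuous.tendsto x).eventually (eventually_gt_nhds ha)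
        obtain ⟨y, hy, hy'⟩ := exists_Ioc_subset_of_mem_nhds h1 ⟨x - 1, by linarith⟩
        obtain ⟨q, hq, hq'⟩ := exists_rat_btwn hy
        exact ⟨q, hy' ⟨hq, hq'.le⟩, hq'⟩
      filter_upwards [((hlim q).eventually (eventually_gt_nhds hq)).prod_mk
        (eventually_gt_nhds hqx)] with p hp
      exact hp.1.trans_le ((hu _).mono hp.2.le)
    · intro a ha
      obtain ⟨q, hq, hqx⟩ : ∃ q : ℚ, h q < a ∧ x < (q : ℝ) := by
        have h1 := (hh.continuous.tendsto x).eventually (eventually_lt_nhds ha)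
        obtain ⟨y, hy, hy'⟩ := exists_Ico_subset_of_mem_nhds h1 ⟨x + 1, by linarith⟩
        obtain ⟨q, hq, hq'⟩ := exists_rat_btwn hy
        exact ⟨q, hy' ⟨hq.le, hq'⟩, hq⟩
      filter_upwards [((hlim q).eventually (eventually_lt_nhds hq)).prod_mk
        (eventually_lt_nhds hqx)] with p hp
      exact ((hu _).mono hp.2.le).trans_lt hp.1

/-- A sequence of normalised quasisymmetric functions has a convergent subsequence. -/
theorem exists_subseq {u : ℕ → ℝ → ℝ} (hu : ∀ n, IsNormalizedQS k (u n)) :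
    ∃ φ : ℕ → ℕ, StrictMono φ ∧ ∃ (h : ℝ → ℝ) (hh : IsNormalizedQS k h),
      ∀ x, ConvAt (fun n => (hu (φ n)).homeo) x (hh.homeo x) := by
  choose C hC using exists_bound k
  obtain ⟨G, -, φ, hφ, hG⟩ := (isCompact_univ_pi fun q : ℚ =>
    isCompact_Icc (a := -C q) (b := C q)).tendsto_subseq (x := fun n (q : ℚ) => u n q)
    fun n q _ => hC q _ (hu n)
  -- The subsequence converges only at rationals so far. A limit along a free ultrafilter supplies
  -- values at all reals, enough to inherit the inequalities; continuity of `H` then upgrades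
  -- convergence on `ℚ`.
  have hU (x : ℝ) : ∃ y, Tendsto (fun n => u (φ n) x) (hyperfilter ℕ : Filter ℕ) (𝓝 y) := by
    obtain ⟨y, -, hy⟩ := (isCompact_Icc (a := -C x) (b := C x)).ultrafilter_le_nhds
      ((hyperfilter ℕ).map fun n => u (φ n) x)
      (tendsto_principal.2 (Eventually.of_forall fun n => hC x _ (hu (φ n))))
    exact ⟨y, hy⟩
  choose H hH using hU
  have hHG (q : ℚ) : Tendsto (fun n => u (φ n) q) atTop (𝓝 (H q)) := by
    have h1 : Tendsto (fun n => u (φ n) q) atTop (𝓝 (G q)) := tendsto_pi_nhds.1 hG q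
    rwa [tendsto_nhds_unique (hH q) (h1.mono_left Nat.hyperfilter_le_atTop)]
  have hh : IsNormalizedQS k H := of_tendsto (fun n => hu (φ n)) hH
  exact ⟨φ, hφ, H, hh, convAt_homeo (fun n => hu (φ n)) hh hHG⟩

end IsNormalizedQS

/-! ### Convergence families -/

theorem exists_normalization {k : ℝ} (hk : 0 < k) {f : RHat ≃ₜ RHat} (hf : IsQuasisymmetric k f) :
    ∃ (g : Matrix.SpecialLinearGroup (Fin 2) ℝ) (h : ℝ → ℝ) (hh : IsNormalizedQS k h),
      f = moebius g * hh.homeo := by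
  obtain ⟨hf0, m, ⟨g, rfl⟩, hinf, h, hh, hqs⟩ := hf
  have hmf : OrientationPreserving (moebius g * f) := (orientationPreserving_moebius g).mul hf0
  have hmono : StrictMono h := by
    intro x y hxy
    have h1 := hmf x y ∞ (by simpa [Cyc] using hxy)
    change Cyc (moebius g (f x)) (moebius g (f y)) (moebius g (f ∞)) at h1
    rw [hh, hh, hinf] at h1
    exact h1
  have hα : 0 < h 1 - h 0 := sub_pos.2 (hmono one_pos)
  have hle (x t : ℝ) (ht : 0 < t) : h (x + t) - h x ≤ k * (h x - h (x - t)) := by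
    have hp : 0 < h x - h (x - t) := sub_pos.2 (hmono (by linarith))
    exact (div_le_iff₀ hp).1 (hqs x t ht).2
  have hge (x t : ℝ) (ht : 0 < t) : h x - h (x - t) ≤ k * (h (x + t) - h x) := by
    have hp : 0 < h x - h (x - t) := sub_pos.2 (hmono (by linarith))
    have := (div_le_div_iff₀ hk hp).1 (hqs x t ht).1
    linarith
  have hN : IsNormalizedQS k fun x => (h x - h 0) / (h 1 - h 0) :=
    { mono := fun x y hxy => by
        have := hmono.monotone hxy
        dsimp only
        gcongr
      zero := by simp
      one := div_self hα.ne'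
      right_le := fun x t ht => by
        rw [← sub_div, ← sub_div, ← mul_div_assoc]
        have := hle x t ht
        gcongr
        linarith
      left_le := fun x t ht => by
        rw [← sub_div, ← sub_div, ← mul_div_assoc]
        have := hge x t ht
        gcongr
        linarith }
  set s := √(h 1 - h 0) with hs
  have hs0 : s ≠ 0 := (Real.sqrt_pos.2 hα).ne'
  have hss : s * s = h 1 - h 0 := Real.mul_self_sqrt hα.le
  -- The matrix of `y ↦ s ^ 2 * y + h 0`, which undoes the affine normalisation.
  let A : Matrix.SpecialLinearGroup (Fin 2) ℝ :=
    ⟨!![s, h 0 / s; 0, s⁻¹], by simp [Matrix.det_fin_two, hs0]⟩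
  refine ⟨g⁻¹ * A, _, hN, ?_⟩
  rw [map_mul, map_inv, mul_assoc, eq_inv_mul_iff_mul_eq]
  ext x
  change moebius g (f x) = moebius A (hN.homeo x)
  induction x using OnePoint.rec with
  | infty =>
    rw [hinf, hN.homeo_infty, moebius_infty]
    simp [A, pt]
  | coe x =>
    rw [hh, hN.homeo_coe, moebius_coe]
    simp only [A, pt, Matrix.of_apply, Matrix.cons_val', Matrix.cons_val_zero,
      Matrix.cons_val_one, zero_mul, zero_add, inv_eq_zero, hs0, if_false]
    congr 1
    rw [← hss]
    field_simp
    ring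

theorem UniformlyQuasisymmetric.isConvergenceFamily {F : Set (RHat ≃ₜ RHat)}
    (hF : UniformlyQuasisymmetric F) : IsConvergenceFamily F := by
  obtain ⟨k, hk, hF⟩ := hF
  refine ⟨fun f hf => (hF f hf).1, fun u hu => ?_⟩
  choose g h hh hgh using fun n => exists_normalization hk (hF _ (hu n))
  obtain ⟨φ, hφ, H, hH, hconv⟩ := IsNormalizedQS.exists_subseq hh
  obtain ⟨ψ, hψ, hm⟩ := moebius_subseq fun n => g (φ n)
  have hconv' (x : RHat) : ConvAt (fun n => (hh (φ (ψ n))).homeo) x (hH.homeo x) :=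
    (hconv x).subseq hψ
  have hu' (n : ℕ) : ⇑(u (φ (ψ n))) =
      fun x => moebius (g (φ (ψ n))) ((hh (φ (ψ n))).homeo x) := by
    rw [hgh]; rfl
  refine ⟨φ ∘ ψ, hφ.comp hψ, ?_⟩
  rcases hm with ⟨m, hm⟩ | ⟨a, r, har⟩
  · left
    refine ⟨moebius m * hH.homeo,
      (orientationPreserving_moebius m).mul hH.orientationPreserving_homeo, ?_⟩
    refine uniformConvOn_of_convAt isCompact_univ (moebius m * hH.homeo).continuous fun x _ => ?_
    simp only [Function.comp_apply, hu']
    exact (hm (hH.homeo x)).comp (hconv' x)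
  · right
    refine ⟨a, hH.homeo.symm r, fun U hU hr => ?_⟩
    refine uniformConvOn_of_convAt hU.isClosed_compl.isCompact continuous_const fun x hx => ?_
    simp only [Function.comp_apply, hu']
    refine (har (hH.homeo x) fun hxr => hx ?_).comp (hconv' x)
    rwa [← hxr, Homeomorph.symm_apply_apply] at hr

theorem uniformlyQuasisymmetric_mobPlus :
    UniformlyQuasisymmetric (mobPlus : Set (RHat ≃ₜ RHat)) := by
  -- Postcomposition with `f⁻¹` gives the identity, whose quotients all equal `1`.
  refine ⟨1, one_pos, fun f hf => ⟨?_, f⁻¹, mobPlus.inv_mem hf, f.symm_apply_apply ∞, id,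
    fun x => f.symm_apply_apply _, fun x t ht => ?_⟩⟩
  · obtain ⟨g, rfl⟩ := hf
    exact orientationPreserving_moebius g
  · have : (id (x + t) - id x) / (id x - id (x - t)) = 1 := by
      simp [ht.ne']
    rw [this]
    norm_num

end RHat

theorem proposition3p1 :
    (∀ F : Set (RHat ≃ₜ RHat), RHat.UniformlyQuasisymmetric F → RHat.IsConvergenceFamily F) ∧
      RHat.IsConvergenceGroup RHat.mobPlus :=
  ⟨fun _ hF => hF.isConvergenceFamily,
    RHat.uniformlyQuasisymmetric_mobPlus.isConvergenceFamily⟩
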